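/- Let $n,k\ge 0$ be integers, let $1\le p<\infty$ be a real number, and let $W^{k,p}(\mathbb{R}^n)$ be the Sobolev space of (real- or complex-valued) measurable functions $f$ on $\mathbb{R}^n$, modulo equality almost everywhere, which together with all their distributional derivatives $D^\alpha f$ of order $|\alpha|\le k$ belong to $L^p(\mathbb{R}^n)$, with the norm \[\|f\|_{k,p}=\Bigl(\int_{\mathbb{R}^n}\sum_{|\alpha|\le k}|D^\alpha f(x)|^p\,dx\Bigr)^{1/p}.\] Here $\alpha$ ranges over multi-indices in $\mathbb{Z}_{\ge0}^n$ and $|\alpha|=\alpha_1+\dots+\alpha_n$. A subset $\mathcal{F}\subseteq W^{k,p}(\mathbb{R}^n)$ is totally bounded with respect to this norm if and only if the following three conditions hold: (i) there is some $M\in\mathbb{R}$ such that \[\int_{\mathbb{R}^n}|D^\alpha f(x)|^p\,dx<M\quad\text{for all } f\in\mathcal{F} \text{ and all } |\alpha|\le k;\] (ii) for every $\epsilon>0$ there is some $R\in\mathbb{R}$ such that \[\int_{|x|>R}|D^\alpha f(x)|^p\,dx<\epsilon^p\quad\text{for all } f\in\mathcal{F} \text{ and all } |\alpha|\le k;\]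 (iii) for every $\epsilon>0$ there is some $\rho>0$ such that \[\int_{\mathbb{R}^n}|D^\alpha f(x+y)-D^\alpha f(x)|^p\,dx<\epsilon^p\quad\text{for all } f\in\mathcal{F},\ |\alpha|\le k \text{ and } y\in\mathbb{R}^n \text{ with } |y|<\rho.\] -/

import Mathlib

open MeasureTheory
open scoped NNReal ENNReal ContDiff

noncomputable section

/-- Multi-indices `α = (α₁, …, αₙ)` of nonnegative integers with `|α| = α₁ + ⋯ + αₙ ≤ k`. -/
abbrev MultiIndex (n k : ℕ) : Type := {α : Fin n → ℕ // ∑ i, α i ≤ k}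

instance multiIndexFinite (n k : ℕ) : Finite (MultiIndex n k) := by
  refine ((Set.Finite.pi' (fun _ : Fin n => Set.finite_Iic k)).subset
    (s := {f : Fin n → ℕ | ∀ i, f i ∈ Set.Iic k}) ?_ :
      {α : Fin n → ℕ | ∑ i, α i ≤ k}.Finite).to_subtype
  intro α hα i
  exact (Finset.single_le_sum (f := α) (fun _ _ => Nat.zero_le _) (Finset.mem_univ i)).trans hα

instance multiIndexFintype (n k : ℕ) : Fintype (MultiIndex n k) := Fintype.ofFinite _

/-- The classical partial derivative `∂φ/∂xᵢ`. -/
def partialDeriv {n : ℕ} (i : Fin n) (φ : EuclideanSpace ℝ (Fin n) → ℝ) :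
    EuclideanSpace ℝ (Fin n) → ℝ :=
  fun x => fderiv ℝ φ x (EuclideanSpace.single i 1)

/-- The classical derivative `D^α φ = ∂^{|α|} φ / (∂x₁^{α₁} ⋯ ∂xₙ^{αₙ})`. -/
def classicalDeriv {n : ℕ} (α : Fin n → ℕ) (φ : EuclideanSpace ℝ (Fin n) → ℝ) :
    EuclideanSpace ℝ (Fin n) → ℝ :=
  (List.finRange n).foldr (fun i ψ => (partialDeriv i)^[α i] ψ) φ

theorem classicalDeriv_smooth_compact {n : ℕ} (α : Fin n → ℕ)
    {φ : EuclideanSpace ℝ (Fin n) → ℝ} (hφ : ContDiff ℝ ∞ φ) (hc : HasCompactSupport φ) :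
    ContDiff ℝ ∞ (classicalDeriv α φ) ∧ HasCompactSupport (classicalDeriv α φ) := by
  have step : ∀ (i : Fin n) (ψ : EuclideanSpace ℝ (Fin n) → ℝ),
      ContDiff ℝ ∞ ψ ∧ HasCompactSupport ψ →
        ContDiff ℝ ∞ (partialDeriv i ψ) ∧ HasCompactSupport (partialDeriv i ψ) := fun i ψ h =>
    ⟨(h.1.fderiv_right (m := ∞) (by simp)).clm_apply contDiff_const, h.2.fderiv_apply ℝ _⟩
  have iter : ∀ (i : Fin n) (m : ℕ) (ψ : EuclideanSpace ℝ (Fin n) → ℝ),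
      ContDiff ℝ ∞ ψ ∧ HasCompactSupport ψ →
        ContDiff ℝ ∞ ((partialDeriv i)^[m] ψ) ∧
          HasCompactSupport ((partialDeriv i)^[m] ψ) := by
    intro i m
    induction m with
    | zero => exact fun ψ h => h
    | succ m ih => exact fun ψ h => ih _ (step i ψ h)
  unfold classicalDeriv
  induction List.finRange n with
  | nil => exact ⟨hφ, hc⟩
  | cons i l ih => exact iter i _ _ ih

/-- `g` is the distributional derivative `D^α f`: for every test function `φ ∈ C_c^∞(ℝⁿ)`,
`∫ (D^α φ) f = (-1)^{|α|} ∫ φ g`. -/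
def IsDistribDeriv {𝕜 : Type*} [RCLike 𝕜] {n : ℕ} (α : Fin n → ℕ)
    (f g : EuclideanSpace ℝ (Fin n) → 𝕜) : Prop :=
  ∀ φ : EuclideanSpace ℝ (Fin n) → ℝ, ContDiff ℝ ∞ φ → HasCompactSupport φ →
    ∫ x, classicalDeriv α φ x • f x = (-1 : ℝ) ^ (∑ i, α i) • ∫ x, φ x • g x

theorem IsDistribDeriv.congr {𝕜 : Type*} [RCLike 𝕜] {n : ℕ} {α : Fin n → ℕ}
    {f f' g g' : EuclideanSpace ℝ (Fin n) → 𝕜} (h : IsDistribDeriv α f g)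
    (hf : f =ᵐ[volume] f') (hg : g =ᵐ[volume] g') : IsDistribDeriv α f' g' := by
  intro φ hφ hc
  have e1 : ∫ x, classicalDeriv α φ x • f' x = ∫ x, classicalDeriv α φ x • f x :=
    integral_congr_ae (by filter_upwards [hf] with x hx using by rw [hx])
  have e2 : ∫ x, φ x • g' x = ∫ x, φ x • g x :=
    integral_congr_ae (by filter_upwards [hg] with x hx using by rw [hx])
  rw [e1, e2]
  exact h φ hφ hc

theorem IsDistribDeriv.add {𝕜 : Type*} [RCLike 𝕜] {n : ℕ} {α : Fin n → ℕ}
    {f f' g g' : EuclideanSpace ℝ (Fin n) → 𝕜}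
    (hf : LocallyIntegrable f) (hf' : LocallyIntegrable f')
    (hg : LocallyIntegrable g) (hg' : LocallyIntegrable g')
    (h : IsDistribDeriv α f g) (h' : IsDistribDeriv α f' g') :
    IsDistribDeriv α (f + f') (g + g') := by
  intro φ hφ hc
  obtain ⟨hD, hDc⟩ := classicalDeriv_smooth_compact α hφ hc
  simp only [Pi.add_apply, smul_add]
  rw [integral_add (hf.integrable_smul_left_of_hasCompactSupport hD.continuous hDc)
      (hf'.integrable_smul_left_of_hasCompactSupport hD.continuous hDc),
    integral_add (hg.integrable_smul_left_of_hasCompactSupport hφ.continuous hc)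
      (hg'.integrable_smul_left_of_hasCompactSupport hφ.continuous hc),
    h φ hφ hc, h' φ hφ hc, smul_add]

theorem IsDistribDeriv.const_smul {𝕜 : Type*} [RCLike 𝕜] {n : ℕ} {α : Fin n → ℕ}
    {f g : EuclideanSpace ℝ (Fin n) → 𝕜} (c : 𝕜) (h : IsDistribDeriv α f g) :
    IsDistribDeriv α (c • f) (c • g) := by
  intro φ hφ hc
  simp only [Pi.smul_apply, smul_comm _ c]
  rw [integral_smul, integral_smul, h φ hφ hc, smul_comm]

theorem IsDistribDeriv.unique {𝕜 : Type*} [RCLike 𝕜] {n : ℕ} {α : Fin n → ℕ}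
    {f g g' : EuclideanSpace ℝ (Fin n) → 𝕜}
    (hg : LocallyIntegrable g) (hg' : LocallyIntegrable g')
    (h : IsDistribDeriv α f g) (h' : IsDistribDeriv α f g') : g =ᵐ[volume] g' := by
  refine ae_eq_of_integral_contDiff_smul_eq hg hg' fun φ hφ hc => ?_
  have := (h φ hφ hc).symm.trans (h' φ hφ hc)
  exact smul_right_injective 𝕜 (pow_ne_zero _ (by norm_num : (-1 : ℝ) ≠ 0)) this

theorem IsDistribDeriv.self {𝕜 : Type*} [RCLike 𝕜] {n : ℕ}
    (f : EuclideanSpace ℝ (Fin n) → 𝕜) : IsDistribDeriv 0 f f := by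
  intro φ _ _
  have : classicalDeriv 0 φ = φ := by
    unfold classicalDeriv
    induction List.finRange n with
    | nil => rfl
    | cons i l ih => simp
  simp [this]

instance factOneLeCoe {p : ℝ≥0} [h : Fact (1 ≤ p)] : Fact ((1 : ℝ≥0∞) ≤ p) :=
  ⟨by exact_mod_cast h.out⟩

theorem lpLocallyIntegrable {𝕜 : Type*} [RCLike 𝕜] {n : ℕ} {p : ℝ≥0} [h : Fact (1 ≤ p)]
    (f : Lp 𝕜 p (volume : Measure (EuclideanSpace ℝ (Fin n)))) :
    LocallyIntegrable (f : EuclideanSpace ℝ (Fin n) → 𝕜) volume :=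
  (Lp.memLp f).locallyIntegrable Fact.out

/-- The linear space underlying `W^{k,p}(ℝⁿ)`, as a subspace of `L^p(ℝⁿ)`: the `f ∈ L^p` all of
whose distributional derivatives `D^α f` with `|α| ≤ k` belong to `L^p`. -/
def sobolevSubmodule (𝕜 : Type*) [RCLike 𝕜] (n k : ℕ) (p : ℝ≥0) [Fact (1 ≤ p)] :
    Submodule 𝕜 (Lp 𝕜 p (volume : Measure (EuclideanSpace ℝ (Fin n)))) where
  carrier := {f | ∀ α : MultiIndex n k,
    ∃ g : Lp 𝕜 p (volume : Measure (EuclideanSpace ℝ (Fin n))), IsDistribDeriv α.1 f g}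
  zero_mem' := fun α => ⟨0, by
    have h0 : IsDistribDeriv (𝕜 := 𝕜) α.1 (0 : EuclideanSpace ℝ (Fin n) → 𝕜) 0 := by
      intro φ _ _
      simp
    exact h0.congr (Lp.coeFn_zero _ _ _).symm (Lp.coeFn_zero _ _ _).symm⟩
  add_mem' := fun {f f'} hf hf' α => by
    obtain ⟨g, hg⟩ := hf α
    obtain ⟨g', hg'⟩ := hf' α
    exact ⟨g + g', (hg.add (lpLocallyIntegrable _) (lpLocallyIntegrable _)
      (lpLocallyIntegrable _) (lpLocallyIntegrable _) hg').congr
        (Lp.coeFn_add _ _).symm (Lp.coeFn_add _ _).symm⟩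
  smul_mem' := fun c f hf α => by
    obtain ⟨g, hg⟩ := hf α
    exact ⟨c • g, (hg.const_smul c).congr
      (Lp.coeFn_smul _ _).symm (Lp.coeFn_smul _ _).symm⟩

/-- The Sobolev space `W^{k,p}(ℝⁿ)` of `𝕜`-valued functions, `1 ≤ p < ∞`. It is a type of its own,
so that it carries the Sobolev norm below, not the norm of `L^p`. -/
def SobolevSpace (𝕜 : Type*) [RCLike 𝕜] (n k : ℕ) (p : ℝ≥0) [Fact (1 ≤ p)] : Type _ :=
  sobolevSubmodule 𝕜 n k p

namespace SobolevSpace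

variable {𝕜 : Type*} [RCLike 𝕜] {n k : ℕ} {p : ℝ≥0} [Fact (1 ≤ p)]

instance instAddCommGroup : AddCommGroup (SobolevSpace 𝕜 n k p) :=
  inferInstanceAs (AddCommGroup (sobolevSubmodule 𝕜 n k p))

instance instModule : Module 𝕜 (SobolevSpace 𝕜 n k p) :=
  inferInstanceAs (Module 𝕜 (sobolevSubmodule 𝕜 n k p))

/-- The inclusion `W^{k,p}(ℝⁿ) ⊆ L^p(ℝⁿ)`. -/
def toLp : SobolevSpace 𝕜 n k p →ₗ[𝕜] Lp 𝕜 p (volume : Measure (EuclideanSpace ℝ (Fin n))) :=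
  (sobolevSubmodule 𝕜 n k p).subtype

theorem toLp_injective : Function.Injective (toLp (𝕜 := 𝕜) (n := n) (k := k) (p := p)) :=
  Subtype.val_injective

/-- The distributional derivative `D^α f ∈ L^p(ℝⁿ)` of `f ∈ W^{k,p}(ℝⁿ)`, where `|α| ≤ k`. -/
def deriv (α : MultiIndex n k) (f : SobolevSpace 𝕜 n k p) :
    Lp 𝕜 p (volume : Measure (EuclideanSpace ℝ (Fin n))) :=
  (f.2 α).choose

theorem deriv_spec (α : MultiIndex n k) (f : SobolevSpace 𝕜 n k p) :
    IsDistribDeriv α.1 (toLp f) (deriv α f) :=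
  (f.2 α).choose_spec

theorem deriv_unique (α : MultiIndex n k) (f : SobolevSpace 𝕜 n k p)
    (g : Lp 𝕜 p (volume : Measure (EuclideanSpace ℝ (Fin n))))
    (hg : IsDistribDeriv α.1 (toLp f) g) : deriv α f = g :=
  Lp.ext ((deriv_spec α f).unique (lpLocallyIntegrable _) (lpLocallyIntegrable _) hg)

theorem deriv_add (α : MultiIndex n k) (f g : SobolevSpace 𝕜 n k p) :
    deriv α (f + g) = deriv α f + deriv α g := by
  refine deriv_unique α _ _ ?_
  rw [map_add]
  exact ((deriv_spec α f).add (lpLocallyIntegrable _) (lpLocallyIntegrable _)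
    (lpLocallyIntegrable _) (lpLocallyIntegrable _) (deriv_spec α g)).congr
      (Lp.coeFn_add _ _).symm (Lp.coeFn_add _ _).symm

theorem deriv_smul (α : MultiIndex n k) (c : 𝕜) (f : SobolevSpace 𝕜 n k p) :
    deriv α (c • f) = c • deriv α f := by
  refine deriv_unique α _ _ ?_
  rw [map_smul]
  exact ((deriv_spec α f).const_smul c).congr
    (Lp.coeFn_smul _ _).symm (Lp.coeFn_smul _ _).symm

theorem deriv_zero_index (f : SobolevSpace 𝕜 n k p) : deriv ⟨0, by simp⟩ f = toLp f :=
  deriv_unique _ _ _ (IsDistribDeriv.self _)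

/-- The Sobolev norm `‖f‖_{k,p} = (∫ ∑_{|α| ≤ k} |D^α f(x)|^p dx)^{1/p}`. -/
instance instNorm : Norm (SobolevSpace 𝕜 n k p) where
  norm f := (∫ x, ∑ α : MultiIndex n k, ‖deriv α f x‖ ^ (p : ℝ)) ^ (1 / (p : ℝ))

theorem norm_def (f : SobolevSpace 𝕜 n k p) :
    ‖f‖ = (∫ x, ∑ α : MultiIndex n k, ‖deriv α f x‖ ^ (p : ℝ)) ^ (1 / (p : ℝ)) := rfl

/-- The family of all derivatives of order at most `k`, as an element of an `ℓ^p` sum. -/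
def jet (f : SobolevSpace 𝕜 n k p) : PiLp (p : ℝ≥0∞)
    (fun _ : MultiIndex n k => Lp 𝕜 p (volume : Measure (EuclideanSpace ℝ (Fin n)))) :=
  WithLp.toLp _ fun α => deriv α f

theorem norm_eq_norm_jet (f : SobolevSpace 𝕜 n k p) : ‖f‖ = ‖jet f‖ := by
  have hp : (0 : ℝ) < p := lt_of_lt_of_le one_pos (by exact_mod_cast (Fact.out : 1 ≤ p))
  have hp0 : (p : ℝ≥0∞) ≠ 0 := by
    have : p ≠ 0 := fun h => by simp [h] at hp
    exact_mod_cast this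
  have key : ∀ g : Lp 𝕜 p (volume : Measure (EuclideanSpace ℝ (Fin n))),
      ∫ x, ‖g x‖ ^ (p : ℝ) = ‖g‖ ^ (p : ℝ) := by
    intro g
    have hI : 0 ≤ ∫ x, ‖g x‖ ^ (p : ℝ) :=
      integral_nonneg fun x => Real.rpow_nonneg (norm_nonneg _) _
    rw [Lp.norm_def, (Lp.memLp g).eLpNorm_eq_integral_rpow_norm hp0 ENNReal.coe_ne_top,
      ENNReal.coe_toReal, ENNReal.toReal_ofReal (Real.rpow_nonneg hI _),
      Real.rpow_inv_rpow hI hp.ne']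
  rw [norm_def, PiLp.norm_eq_sum (by simpa using hp), ENNReal.coe_toReal,
    integral_finsetSum]
  · simp only [key]
    rfl
  · intro α _
    simpa using (Lp.memLp (deriv α f)).integrable_norm_rpow hp0 ENNReal.coe_ne_top

theorem jet_add (f g : SobolevSpace 𝕜 n k p) : jet (f + g) = jet f + jet g := by
  ext1 α
  exact deriv_add α f g

theorem jet_smul (c : 𝕜) (f : SobolevSpace 𝕜 n k p) : jet (c • f) = c • jet f := by
  ext1 α
  exact deriv_smul α c f

theorem normedSpaceCore : NormedSpace.Core 𝕜 (SobolevSpace 𝕜 n k p) where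
  norm_nonneg f := by
    rw [norm_eq_norm_jet]
    exact norm_nonneg _
  norm_smul c f := by
    rw [norm_eq_norm_jet, norm_eq_norm_jet, jet_smul, norm_smul]
  norm_triangle f g := by
    rw [norm_eq_norm_jet, norm_eq_norm_jet, norm_eq_norm_jet, jet_add]
    exact norm_add_le _ _
  norm_eq_zero_iff f := by
    rw [norm_eq_norm_jet, norm_eq_zero]
    constructor
    · intro h
      apply toLp_injective
      rw [map_zero, ← deriv_zero_index]
      exact congrArg (fun v => v.ofLp ⟨0, by simp⟩) h
    · rintro rfl
      have := jet_smul (0 : 𝕜) (0 : SobolevSpace 𝕜 n k p)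
      simpa using this

/-- `W^{k,p}(ℝⁿ)` with the metric of the Sobolev norm. -/
instance instNormedAddCommGroup : NormedAddCommGroup (SobolevSpace 𝕜 n k p) :=
  NormedAddCommGroup.ofCore (normedSpaceCore (𝕜 := 𝕜) (n := n) (k := k) (p := p))

instance instNormedSpace : NormedSpace 𝕜 (SobolevSpace 𝕜 n k p) :=
  NormedSpace.ofCore (normedSpaceCore (𝕜 := 𝕜) (n := n) (k := k) (p := p))

end SobolevSpace

end

/-! ### Total boundedness in uniform and metric spaces -/

section TotallyBounded

open Filter Topology

/-! The map `jet` embeds `W^{k,p}` isometrically into a finite `ℓ^p` sum of copies of `L^p`, so `F`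
is totally bounded exactly when each family `D^α F` is so in `L^p`. This reduces everything to the
Kolmogorov–Riesz theorem `totallyBounded_Lp_iff`.

Necessity there: tails and translation displacements of a single function tend to zero, and both
depend on the function in a Lipschitz way, so a finite net makes the convergence uniform
(`TotallyBounded.eventually_forall_lt`).

Sufficiency: averaging over balls of radius `δ` moves each function little in `L^p`
(`eLpNorm_ballAverage_sub_le`), while the averages are uniformly bounded and equicontinuous. On a
large ball they are thus controlled by their values at finitely many points, and these form a
bounded set in a finite-dimensional space. Closeness of the sampled values forces closeness in `L^p`
(`eLpNorm_sub_le_of_ballAverage`), so a finite net of samples pulls back to one of functions. -/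

theorem exists_finite_net_of_totallyBounded_image {X Y : Type*} [PseudoMetricSpace X]
    [PseudoMetricSpace Y] {s : Set X} {Φ : X → Y} (hΦ : TotallyBounded (Φ '' s)) {δ ε : ℝ}
    (hδ : 0 < δ) (h : ∀ x ∈ s, ∀ y ∈ s, dist (Φ x) (Φ y) < δ → dist x y < ε) :
    ∃ t : Set X, t.Finite ∧ s ⊆ ⋃ y ∈ t, Metric.ball y ε := by
  obtain ⟨u, hus, huf, hu⟩ := Metric.finite_approx_of_totallyBounded hΦ δ hδ
  obtain ⟨t, hts, htf, rfl⟩ := Set.exists_subset_image_finite_and.1 ⟨u, hus, huf, rfl⟩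
  refine ⟨t, htf, fun x hx => ?_⟩
  have := hu (Set.mem_image_of_mem Φ hx)
  simp only [Set.mem_iUnion, Set.mem_image, exists_prop] at this ⊢
  obtain ⟨_, ⟨y, hy, rfl⟩, hxy⟩ := this
  exact ⟨y, hy, h x hx y (hts hy) hxy⟩

/-- Total boundedness says that every ultrafilter on the set is Cauchy. Ultrafilters push forward
along projections, and being Cauchy in a product is checked coordinatewise. -/
theorem totallyBounded_pi_iff {ι : Type*} [Nonempty ι] {X : ι → Type*}
    [∀ i, UniformSpace (X i)] {s : Set (∀ i, X i)} :
    TotallyBounded s ↔ ∀ i, TotallyBounded ((fun x => x i) '' s) := by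
  refine ⟨fun h i => h.image (Pi.uniformContinuous_proj X i), fun h => ?_⟩
  refine totallyBounded_iff_ultrafilter.2 fun f hf => ?_
  rw [cauchy_pi_iff]
  intro i
  have := totallyBounded_iff_ultrafilter.1 (h i) (f.map fun x => x i) (by
    rw [Ultrafilter.coe_map, le_principal_iff]
    exact image_mem_map (le_principal_iff.1 hf))
  simpa using this

theorem TotallyBounded.eventually_forall_lt {ι X : Type*} [PseudoMetricSpace X] {s : Set X}
    (hs : TotallyBounded s) {l : Filter ι} {φ : ι → X → ℝ} {C : ℝ}
    (hφ : ∀ i x y, φ i x ≤ φ i y + C * dist x y) (hl : ∀ x, Tendsto (φ · x) l (𝓝 0))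
    {ε : ℝ} (hε : 0 < ε) : ∀ᶠ i in l, ∀ x ∈ s, φ i x < ε := by
  -- No sign is assumed for `C`; this is a positive upper bound by which one can divide.
  have hC : 0 < |C| + 1 := by positivity
  obtain ⟨t, htf, ht⟩ := Metric.totallyBounded_iff.1 hs (ε / 2 / (|C| + 1)) (by positivity)
  have := (eventually_all_finite htf).2 fun y _ => (hl y).eventually_lt_const (half_pos hε)
  filter_upwards [this] with i hi x hx
  obtain ⟨y, hy, hxy⟩ := Set.mem_iUnion₂.1 (ht hx)
  have h1 := hi y hy
  have h2 : (|C| + 1) * dist x y < ε / 2 := by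
    rw [mul_comm]; exact (lt_div_iff₀ hC).1 hxy
  have h3 : C * dist x y ≤ (|C| + 1) * dist x y := by
    gcongr
    linarith [le_abs_self C]
  linarith [hφ i x y]

end TotallyBounded

/-! ### Averages over small balls -/

section KolmogorovRiesz

open Filter Topology Metric ProbabilityTheory

variable {E G : Type*} [NormedAddCommGroup E] [MeasurableSpace E] [NormedAddCommGroup G]
  {p : ℝ≥0∞} {μ : Measure E}

theorem enorm_integral_le_eLpNorm {α : Type*} [MeasurableSpace α] [NormedSpace ℝ G]
    {ν : Measure α} [IsProbabilityMeasure ν] (hp : 1 ≤ p) {f : α → G}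
    (hf : AEStronglyMeasurable f ν) : ‖∫ x, f x ∂ν‖ₑ ≤ eLpNorm f p ν := by
  refine (enorm_integral_le_lintegral_enorm f).trans ?_
  rw [← eLpNorm_one_eq_lintegral_enorm]
  exact eLpNorm_le_eLpNorm_of_exponent_le hp hf

theorem eLpNorm_cond_le {α : Type*} [MeasurableSpace α] {ν : Measure α} (hp : p ≠ ⊤)
    (f : α → G) (s : Set α) :
    eLpNorm f p (cond ν s) ≤ (ν s)⁻¹ ^ (1 / p).toReal * eLpNorm f p ν := by
  rw [ProbabilityTheory.cond, eLpNorm_smul_measure_of_ne_top hp, smul_eq_mul]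
  exact mul_le_mul_right (eLpNorm_restrict_le f p ν s) _

theorem eLpNorm_le_restrict_add_restrict_compl {α : Type*} [MeasurableSpace α] {ν : Measure α}
    (hp : 1 ≤ p) {f : α → G} (hf : AEStronglyMeasurable f ν) {s : Set α} (hs : MeasurableSet s) :
    eLpNorm f p ν ≤ eLpNorm f p (ν.restrict s) + eLpNorm f p (ν.restrict sᶜ) := by
  rw [← eLpNorm_indicator_eq_eLpNorm_restrict hs,
    ← eLpNorm_indicator_eq_eLpNorm_restrict hs.compl]
  conv_lhs => rw [← Set.indicator_self_add_compl s f]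
  exact eLpNorm_add_le (hf.indicator hs) (hf.indicator hs.compl) hp

theorem MeasureTheory.MemLp.integral_norm_rpow_lt_iff {α : Type*} [MeasurableSpace α]
    {ν : Measure α} {f : α → G} (hf : MemLp f p ν) (h0 : p ≠ 0) (hp : p ≠ ⊤) {ε : ℝ}
    (hε : 0 < ε) :
    ∫ x, ‖f x‖ ^ p.toReal ∂ν < ε ^ p.toReal ↔ eLpNorm f p ν < ENNReal.ofReal ε := by
  have hI : 0 ≤ ∫ x, ‖f x‖ ^ p.toReal ∂ν :=
    integral_nonneg fun x => Real.rpow_nonneg (norm_nonneg _) _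
  rw [hf.eLpNorm_eq_integral_rpow_norm h0 hp, ENNReal.ofReal_lt_ofReal_iff hε,
    Real.rpow_inv_lt_iff_of_pos hI hε.le (ENNReal.toReal_pos h0 hp)]

/-- The average of `f` over the ball of radius `δ` around `x`. -/
noncomputable def ballAverage [NormedSpace ℝ G] (μ : Measure E) (δ : ℝ) (f : E → G) (x : E) : G :=
  ∫ y, f (x + y) ∂(cond μ (ball 0 δ))

variable [NormedSpace ℝ E] [FiniteDimensional ℝ E]

theorem isProbabilityMeasure_cond_ball [μ.IsAddHaarMeasure] {δ : ℝ} (hδ : 0 < δ) :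
    IsProbabilityMeasure (cond μ (ball 0 δ)) :=
  cond_isProbabilityMeasure_of_finite (measure_ball_pos μ 0 hδ).ne' measure_ball_lt_top.ne

variable [BorelSpace E]

theorem stronglyMeasurable_ballAverage [NormedSpace ℝ G] [SFinite μ] {f : E → G}
    (hf : StronglyMeasurable f) (δ : ℝ) :
    StronglyMeasurable (ballAverage μ δ f) := by
  unfold ballAverage
  exact (hf.comp_measurable measurable_add).integral_prod_right' (ν := cond μ (ball 0 δ))

variable [μ.IsAddHaarMeasure]

theorem MeasureTheory.MemLp.integrable_comp_add_left_cond_ball {f : E → G} (hf : MemLp f p μ)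
    (hp : 1 ≤ p) {δ : ℝ} (hδ : 0 < δ) (x : E) :
    Integrable (fun y => f (x + y)) (cond μ (ball 0 δ)) := by
  have := isProbabilityMeasure_cond_ball (μ := μ) hδ
  have h : MemLp (fun y => f (x + y)) p μ :=
    hf.comp_measurePreserving (measurePreserving_add_left μ x)
  have h2 : MemLp (fun y => f (x + y)) p (cond μ (ball 0 δ)) := by
    rw [ProbabilityTheory.cond]
    exact h.restrict _ |>.smul_measure (ENNReal.inv_ne_top.2 (measure_ball_pos μ 0 hδ).ne')
  exact h2.integrable hp

variable [NormedSpace ℝ G]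

/-- On a probability space the `L^1` norm is at most the `L^p` norm, and `μ` is translation
invariant. The constant depends on `δ` but not on `f` or `x`. -/
theorem enorm_ballAverage_le (hp : 1 ≤ p) (hp' : p ≠ ⊤) {f : E → G} (hf : StronglyMeasurable f)
    {δ : ℝ} (hδ : 0 < δ) (x : E) :
    ‖ballAverage μ δ f x‖ₑ ≤ (μ (ball 0 δ))⁻¹ ^ (1 / p).toReal * eLpNorm f p μ := by
  have := isProbabilityMeasure_cond_ball (μ := μ) hδ
  refine (enorm_integral_le_eLpNorm hp
    (hf.comp_measurable (measurable_const_add x)).aestronglyMeasurable).trans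
    ((eLpNorm_cond_le hp' _ _).trans_eq ?_)
  congr 1
  exact eLpNorm_comp_measurePreserving hf.aestronglyMeasurable (measurePreserving_add_left μ x)

/-- The difference of two averages is one average of a translation difference, so smallness of
translations in `L^p` becomes a pointwise modulus of continuity. -/
theorem enorm_ballAverage_sub_le (hp : 1 ≤ p) (hp' : p ≠ ⊤) {f : E → G}
    (hf : StronglyMeasurable f) (hfp : MemLp f p μ) {δ : ℝ} (hδ : 0 < δ) (x x' : E) :
    ‖ballAverage μ δ f x - ballAverage μ δ f x'‖ₑ ≤
      (μ (ball 0 δ))⁻¹ ^ (1 / p).toReal * eLpNorm (fun z => f (z + (x - x')) - f z) p μ := by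
  have := isProbabilityMeasure_cond_ball (μ := μ) hδ
  have hm : StronglyMeasurable fun z => f (z + (x - x')) - f z :=
    (hf.comp_measurable (measurable_add_const _)).sub hf
  have : ballAverage μ δ f x - ballAverage μ δ f x' =
      ballAverage μ δ (fun z => f (z + (x - x')) - f z) x' := by
    unfold ballAverage
    rw [← integral_sub (hfp.integrable_comp_add_left_cond_ball hp hδ x)
      (hfp.integrable_comp_add_left_cond_ball hp hδ x')]
    simp only [show ∀ y, x' + y + (x - x') = x + y from fun y => by abel]
  rw [this]
  exact enorm_ballAverage_le hp hp' hm hδ x'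

/-- At each `x` the error is the average of `f (x + y) - f x` over `y`. Its `p`-th power is at most
the average of the `p`-th powers, and Tonelli then integrates over `x` first. -/
theorem eLpNorm_ballAverage_sub_le [CompleteSpace G] (hp : 1 ≤ p) (hp' : p ≠ ⊤) {f : E → G}
    (hf : StronglyMeasurable f) (hfp : MemLp f p μ) {δ : ℝ} (hδ : 0 < δ) {C : ℝ≥0∞}
    (hC : ∀ y ∈ ball (0 : E) δ, eLpNorm (fun x => f (x + y) - f x) p μ ≤ C) :
    eLpNorm (ballAverage μ δ f - f) p μ ≤ C := by
  have hP := isProbabilityMeasure_cond_ball (μ := μ) hδ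
  have h0 : p ≠ 0 := (one_pos.trans_le hp).ne'
  have hr : 0 < p.toReal := ENNReal.toReal_pos h0 hp'
  have hm : StronglyMeasurable fun z : E × E => f (z.1 + z.2) - f z.1 :=
    (hf.comp_measurable measurable_add).sub (hf.comp_measurable measurable_fst)
  have hpt : ∀ x, ‖(ballAverage μ δ f - f) x‖ₑ ^ p.toReal ≤
      ∫⁻ y, ‖f (x + y) - f x‖ₑ ^ p.toReal ∂(cond μ (ball 0 δ)) := fun x => by
    have e : (ballAverage μ δ f - f) x = ∫ y, (f (x + y) - f x) ∂(cond μ (ball 0 δ)) := by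
      rw [integral_sub (hfp.integrable_comp_add_left_cond_ball hp hδ x) (integrable_const _)]
      simp [ballAverage]
    rw [e]
    have := enorm_integral_le_eLpNorm hp
      (hm.comp_measurable (measurable_prodMk_left (x := x))).aestronglyMeasurable
      (ν := cond μ (ball 0 δ))
    rw [eLpNorm_eq_lintegral_rpow_enorm_toReal h0 hp', one_div,
      ENNReal.le_rpow_inv_iff hr] at this
    exact this
  rw [eLpNorm_eq_lintegral_rpow_enorm_toReal h0 hp', one_div, ENNReal.rpow_inv_le_iff hr]
  refine (lintegral_mono hpt).trans ?_
  rw [lintegral_lintegral_swap (hm.enorm.pow_const _).aemeasurable]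
  calc ∫⁻ y, ∫⁻ x, ‖f (x + y) - f x‖ₑ ^ p.toReal ∂μ ∂(cond μ (ball 0 δ))
      ≤ ∫⁻ _, C ^ p.toReal ∂(cond μ (ball 0 δ)) := by
        refine lintegral_mono_ae ?_
        filter_upwards [ae_cond_mem measurableSet_ball] with y hy
        have := hC y hy
        rwa [eLpNorm_eq_lintegral_rpow_enorm_toReal h0 hp', one_div,
          ENNReal.rpow_inv_le_iff hr] at this
    _ = C ^ p.toReal := by simp

end KolmogorovRiesz

/-! ### The Kolmogorov–Riesz theorem in `L^p` -/

section KolmogorovRieszLp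

open Filter Topology Metric ProbabilityTheory

variable {E G : Type*} [NormedAddCommGroup E] [MeasurableSpace E] [NormedAddCommGroup G]
  {p : ℝ≥0∞} {μ : Measure E}
  [NormedSpace ℝ E] [FiniteDimensional ℝ E] [BorelSpace E] [μ.IsAddHaarMeasure]

theorem ENNReal.exists_pos_mul_ofReal_le {a : ℝ≥0∞} (ha : a ≠ ⊤) {ε : ℝ} (hε : 0 < ε) :
    ∃ η : ℝ, 0 < η ∧ a * ENNReal.ofReal η ≤ ENNReal.ofReal ε := by
  -- The `+ 1` covers the case `a = 0`.
  refine ⟨ε / (a.toReal + 1), by positivity, ?_⟩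
  rw [← ENNReal.ofReal_toReal ha, ← ENNReal.ofReal_mul ENNReal.toReal_nonneg]
  apply ENNReal.ofReal_le_ofReal
  rw [ENNReal.toReal_ofReal ENNReal.toReal_nonneg, ← mul_div_assoc,
    div_le_iff₀ (by positivity)]
  nlinarith [ENNReal.toReal_nonneg (a := a)]

/-- Compactly supported functions are dense for `p < ∞`, and beyond the support of an approximant
`g` the tail of `f` is that of `f - g`. -/
theorem MeasureTheory.MemLp.tendsto_eLpNorm_restrict_norm_gt (hp' : p ≠ ⊤)
    {f : E → G} (hf : MemLp f p μ) [NormedSpace ℝ G] :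
    Tendsto (fun R : ℝ => eLpNorm f p (μ.restrict {x | R < ‖x‖})) atTop (𝓝 0) := by
  rw [ENNReal.tendsto_nhds_zero]
  intro ε hε
  obtain ⟨g, hgc, hg, -, hgp⟩ := hf.exists_hasCompactSupport_eLpNorm_sub_le hp' hε.ne'
  obtain ⟨R₀, hR₀⟩ := hgc.isCompact.isBounded.exists_norm_le
  filter_upwards [eventually_ge_atTop R₀] with R hR
  have hs : MeasurableSet {x : E | R < ‖x‖} := measurableSet_lt measurable_const measurable_norm
  calc eLpNorm f p (μ.restrict {x | R < ‖x‖})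
      = eLpNorm (f - g) p (μ.restrict {x | R < ‖x‖}) := by
        refine eLpNorm_congr_ae ?_
        filter_upwards [ae_restrict_mem hs] with x hx
        have : g x = 0 := image_eq_zero_of_notMem_tsupport fun h =>
          absurd (hR₀ x h) (not_le.2 (hR.trans_lt hx))
        simp [this]
    _ ≤ eLpNorm (f - g) p μ := eLpNorm_restrict_le _ _ _ _
    _ ≤ ε := hg

theorem MeasureTheory.Lp.edist_vadd_self_eq (f : Lp G p μ) (y : E) :
    edist (DomAddAct.mk y +ᵥ f) f = eLpNorm (fun x => f (x + y) - f x) p μ := by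
  rw [Lp.edist_def]
  refine eLpNorm_congr_ae ?_
  filter_upwards [DomAddAct.vadd_Lp_ae_eq (DomAddAct.mk y) f] with x hx
  rw [Pi.sub_apply, hx, Equiv.symm_apply_apply, vadd_eq_add, add_comm]

theorem TotallyBounded.exists_eLpNorm_restrict_norm_gt_lt [NormedSpace ℝ G] [hp : Fact (1 ≤ p)]
    (hp' : p ≠ ⊤) {S : Set (Lp G p μ)} (hS : TotallyBounded S) {ε : ℝ} (hε : 0 < ε) :
    ∃ R : ℝ, ∀ f ∈ S, eLpNorm f p (μ.restrict {x | R < ‖x‖}) < ENNReal.ofReal ε := by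
  have hfin (R : ℝ) (f : Lp G p μ) : eLpNorm f p (μ.restrict {x | R < ‖x‖}) ≠ ⊤ :=
    ((Lp.memLp f).restrict _).eLpNorm_ne_top
  have := hS.eventually_forall_lt (l := atTop) (C := 1)
    (φ := fun (R : ℝ) f => (eLpNorm f p (μ.restrict {x | R < ‖x‖})).toReal) ?_ ?_ hε
  · obtain ⟨R, hR⟩ := this.exists
    exact ⟨R, fun f hf => (ENNReal.lt_ofReal_iff_toReal_lt (hfin R f)).2 (hR f hf)⟩
  · intro R f g
    rw [one_mul, Lp.dist_def, ← ENNReal.toReal_add (hfin R g)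
      ((Lp.memLp f).sub (Lp.memLp g)).eLpNorm_ne_top]
    refine ENNReal.toReal_mono (ENNReal.add_ne_top.2 ⟨hfin R g,
      ((Lp.memLp f).sub (Lp.memLp g)).eLpNorm_ne_top⟩) ?_
    calc eLpNorm f p (μ.restrict {x | R < ‖x‖})
        = eLpNorm (g + (f - g) : E → G) p (μ.restrict {x | R < ‖x‖}) := by simp
      _ ≤ eLpNorm g p (μ.restrict {x | R < ‖x‖}) +
          eLpNorm (f - g : E → G) p (μ.restrict {x | R < ‖x‖}) :=
        eLpNorm_add_le (Lp.stronglyMeasurable g).aestronglyMeasurable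
          ((Lp.stronglyMeasurable f).sub (Lp.stronglyMeasurable g)).aestronglyMeasurable hp.out
      _ ≤ _ := add_le_add le_rfl (eLpNorm_restrict_le _ _ _ _)
  · intro f
    have := (Lp.memLp f).tendsto_eLpNorm_restrict_norm_gt hp'
    exact (ENNReal.tendsto_toReal ENNReal.zero_ne_top).comp this

theorem TotallyBounded.exists_eLpNorm_translate_sub_lt [hp : Fact (1 ≤ p)]
    (hp' : p ≠ ⊤) {S : Set (Lp G p μ)} (hS : TotallyBounded S) {ε : ℝ} (hε : 0 < ε) :
    ∃ ρ : ℝ, 0 < ρ ∧ ∀ f ∈ S, ∀ y : E, ‖y‖ < ρ →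
      eLpNorm (fun x => f (x + y) - f x) p μ < ENNReal.ofReal ε := by
  have : Fact (p ≠ ⊤) := ⟨hp'⟩
  -- Translation is an isometry of `L^p`, so the displacement of `f` is 2-Lipschitz in `f`; it tends
  -- to zero with `y` because the action is continuous.
  have := hS.eventually_forall_lt (l := 𝓝 (0 : E)) (C := 2)
    (φ := fun y f => dist (DomAddAct.mk y +ᵥ f) f) ?_ ?_ hε
  · obtain ⟨ρ, hρ, h⟩ := Metric.eventually_nhds_iff.1 this
    refine ⟨ρ, hρ, fun f hf y hy => ?_⟩
    rw [← Lp.edist_vadd_self_eq, edist_dist, ENNReal.ofReal_lt_ofReal_iff hε]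
    exact h (by simpa using hy) f hf
  · intro y f g
    have h1 := dist_triangle4 (DomAddAct.mk y +ᵥ f) (DomAddAct.mk y +ᵥ g) g f
    rw [DomAddAct.dist_vadd_Lp, dist_comm g f] at h1
    linarith
  · intro f
    have hc : Continuous fun y : E => dist (DomAddAct.mk y +ᵥ f) f :=
      ((DomAddAct.continuous_mk.vadd continuous_const).dist continuous_const)
    have h0 : DomAddAct.mk (0 : E) +ᵥ f = f := zero_vadd _ f
    simpa [h0] using hc.tendsto 0

/-- The five errors are the two tails outside the ball and, inside it, the two averaging errors and
the distance between the averages. -/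
theorem eLpNorm_sub_le_of_ballAverage [NormedSpace ℝ G] [CompleteSpace G] (hp : 1 ≤ p)
    (hp' : p ≠ ⊤) {f g : E → G} (hf : StronglyMeasurable f) (hg : StronglyMeasurable g)
    (hfp : MemLp f p μ) (hgp : MemLp g p μ) {R δ η : ℝ} (hδ : 0 < δ) {e : ℝ≥0∞}
    (hfR : eLpNorm f p (μ.restrict {x | R < ‖x‖}) ≤ e)
    (hgR : eLpNorm g p (μ.restrict {x | R < ‖x‖}) ≤ e)
    (hfδ : ∀ y ∈ ball (0 : E) δ, eLpNorm (fun x => f (x + y) - f x) p μ ≤ e)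
    (hgδ : ∀ y ∈ ball (0 : E) δ, eLpNorm (fun x => g (x + y) - g x) p μ ≤ e)
    (hη : μ (closedBall 0 R) ^ p.toReal⁻¹ * ENNReal.ofReal η ≤ e)
    (h : ∀ x ∈ closedBall (0 : E) R, dist (ballAverage μ δ f x) (ballAverage μ δ g x) ≤ η) :
    eLpNorm (f - g) p μ ≤ 5 * e := by
  have hs : MeasurableSet (closedBall (0 : E) R) := measurableSet_closedBall
  have hcompl : (closedBall (0 : E) R)ᶜ = {x | R < ‖x‖} := by ext; simp
  set Af := ballAverage μ δ f
  set Ag := ballAverage μ δ g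
  have hAf : StronglyMeasurable Af := stronglyMeasurable_ballAverage hf δ
  have hAg : StronglyMeasurable Ag := stronglyMeasurable_ballAverage hg δ
  set ν := μ.restrict (closedBall 0 R)
  have h1 : eLpNorm (f - g) p (μ.restrict {x | R < ‖x‖}) ≤ e + e :=
    (eLpNorm_sub_le hf.aestronglyMeasurable hg.aestronglyMeasurable hp).trans
      (add_le_add hfR hgR)
  have h2 : eLpNorm (Af - f) p ν ≤ e :=
    (eLpNorm_restrict_le _ _ _ _).trans (eLpNorm_ballAverage_sub_le hp hp' hf hfp hδ hfδ)
  have h3 : eLpNorm (Ag - g) p ν ≤ e :=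
    (eLpNorm_restrict_le _ _ _ _).trans (eLpNorm_ballAverage_sub_le hp hp' hg hgp hδ hgδ)
  have h4 : eLpNorm (Af - Ag) p ν ≤ e := by
    refine (eLpNorm_le_of_ae_enorm_bound (C := ENNReal.ofReal η) ?_).trans ?_
    · filter_upwards [ae_restrict_mem hs] with x hx
      rw [Pi.sub_apply, ← edist_eq_enorm_sub, edist_dist]
      exact ENNReal.ofReal_le_ofReal (h x hx)
    · rwa [smul_eq_mul, mul_comm, Measure.restrict_apply_univ]
  have h5 : eLpNorm (f - g) p ν ≤ e + e + e := by
    have : f - g = (Af - Ag) - (Af - f) + (Ag - g) := by abel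
    rw [this]
    refine (eLpNorm_add_le ((hAf.sub hAg).sub (hAf.sub hf)).aestronglyMeasurable
      (hAg.sub hg).aestronglyMeasurable hp).trans ?_
    gcongr
    exact (eLpNorm_sub_le (hAf.sub hAg).aestronglyMeasurable (hAf.sub hf).aestronglyMeasurable
      hp).trans (add_le_add h4 h2)
  calc eLpNorm (f - g) p μ
      ≤ (e + e + e) + (e + e) := by
        refine (eLpNorm_le_restrict_add_restrict_compl hp
          (hf.sub hg).aestronglyMeasurable hs).trans ?_
        rw [hcompl]
        exact add_le_add h5 h1
    _ = 5 * e := by ring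

theorem totallyBounded_Lp_of_tight_of_equicontinuous [NormedSpace ℝ G] [FiniteDimensional ℝ G]
    [hp : Fact (1 ≤ p)] (hp' : p ≠ ⊤) {S : Set (Lp G p μ)}
    (hbdd : ∃ M : ℝ, ∀ f ∈ S, eLpNorm f p μ ≤ ENNReal.ofReal M)
    (htight : ∀ ε : ℝ, 0 < ε → ∃ R : ℝ, ∀ f ∈ S,
      eLpNorm f p (μ.restrict {x | R < ‖x‖}) < ENNReal.ofReal ε)
    (hequi : ∀ ε : ℝ, 0 < ε → ∃ ρ : ℝ, 0 < ρ ∧ ∀ f ∈ S, ∀ y : E, ‖y‖ < ρ →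
      eLpNorm (fun x => f (x + y) - f x) p μ < ENNReal.ofReal ε) :
    TotallyBounded S := by
  have : CompleteSpace G := FiniteDimensional.complete ℝ G
  have : ProperSpace G := FiniteDimensional.proper ℝ G
  have : ProperSpace E := FiniteDimensional.proper ℝ E
  refine Metric.totallyBounded_iff.2 fun ε hε => ?_
  obtain ⟨M, hM⟩ := hbdd
  -- Five errors of size `ε / 6` leave the total strictly below `ε`.
  obtain ⟨R, hR⟩ := htight (ε / 6) (by positivity)
  obtain ⟨δ, hδ, hSδ⟩ := hequi (ε / 6) (by positivity)
  obtain ⟨η, hη, hKη⟩ := ENNReal.exists_pos_mul_ofReal_le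
    (a := μ (closedBall 0 R) ^ p.toReal⁻¹)
    (ENNReal.rpow_ne_top_of_nonneg (by positivity) measure_closedBall_lt_top.ne)
    (show 0 < ε / 6 by positivity)
  have hc : (μ (ball 0 δ))⁻¹ ^ (1 / p).toReal ≠ ⊤ :=
    ENNReal.rpow_ne_top_of_nonneg (by positivity)
      (ENNReal.inv_ne_top.2 (measure_ball_pos μ 0 hδ).ne')
  -- `δ` is already fixed, so the factor coming from the volume of its ball is a constant. The scale
  -- `ρ` is then chosen so that averages vary by at most `η / 3` over distance `ρ`.
  obtain ⟨τ, hτ, hcτ⟩ := ENNReal.exists_pos_mul_ofReal_le hc (show 0 < η / 3 by positivity)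
  obtain ⟨ρ, hρ, hSρ⟩ := hequi τ hτ
  have hav : ∀ f ∈ S, ∀ x x' : E, dist x x' < ρ →
      dist (ballAverage μ δ f x) (ballAverage μ δ f x') ≤ η / 3 := fun f hf x x' hx => by
    rw [← ENNReal.ofReal_le_ofReal_iff (by positivity), ← edist_dist, edist_eq_enorm_sub]
    refine (enorm_ballAverage_sub_le hp.out hp' (Lp.stronglyMeasurable f) (Lp.memLp f) hδ
      x x').trans (le_trans ?_ hcτ)
    gcongr
    exact (hSρ f hf _ (by rwa [← dist_eq_norm])).le
  obtain ⟨t, -, htf, ht⟩ := (isCompact_closedBall (0 : E) R).finite_cover_balls hρ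
  have := htf.fintype
  -- Samples the averages on a finite `ρ`-net of the ball. Two moduli of continuity and one sample
  -- distance, each bounded by `η / 3`, give uniform distance at most `η`.
  let Φ : Lp G p μ → (t → G) := fun f x => ballAverage μ δ f x
  have hΦ : TotallyBounded (Φ '' S) := by
    refine (isCompact_closedBall (0 : t → G)
      ((μ (ball 0 δ))⁻¹ ^ (1 / p).toReal * ENNReal.ofReal M).toReal).totallyBounded.subset ?_
    rintro _ ⟨f, hf, rfl⟩
    rw [mem_closedBall_zero_iff, pi_norm_le_iff_of_nonneg ENNReal.toReal_nonneg]
    intro x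
    rw [← toReal_enorm]
    refine ENNReal.toReal_mono (ENNReal.mul_ne_top hc ENNReal.ofReal_ne_top) ?_
    refine (enorm_ballAverage_le hp.out hp' (Lp.stronglyMeasurable f) hδ _).trans ?_
    gcongr
    exact hM f hf
  refine exists_finite_net_of_totallyBounded_image hΦ (δ := η / 3) (by positivity)
    fun f hf g hg hfg => ?_
  have key := eLpNorm_sub_le_of_ballAverage hp.out hp' (Lp.stronglyMeasurable f)
    (Lp.stronglyMeasurable g) (Lp.memLp f) (Lp.memLp g) hδ (hR f hf).le (hR g hg).le
    (fun y hy => (hSδ f hf y (mem_ball_zero_iff.1 hy)).le)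
    (fun y hy => (hSδ g hg y (mem_ball_zero_iff.1 hy)).le) hKη fun x hx => by
      obtain ⟨x', hx', hxx'⟩ := Set.mem_iUnion₂.1 (ht hx)
      have h1 := hav f hf x x' hxx'
      have h2 := hav g hg x' x (by rwa [dist_comm])
      have h3 : dist (ballAverage μ δ f x') (ballAverage μ δ g x') < η / 3 :=
        (dist_le_pi_dist (Φ f) (Φ g) ⟨x', hx'⟩).trans_lt hfg
      linarith [dist_triangle4 (ballAverage μ δ f x) (ballAverage μ δ f x')
        (ballAverage μ δ g x') (ballAverage μ δ g x)]
  rw [Lp.dist_def]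
  refine (ENNReal.toReal_mono (ENNReal.mul_ne_top (by simp) ENNReal.ofReal_ne_top) key).trans_lt ?_
  rw [ENNReal.toReal_mul, ENNReal.toReal_ofReal (by positivity)]
  norm_num
  linarith

/-- The Kolmogorov–Riesz compactness theorem. -/
theorem totallyBounded_Lp_iff [NormedSpace ℝ G] [FiniteDimensional ℝ G]
    [hp : Fact (1 ≤ p)] (hp' : p ≠ ⊤) {S : Set (Lp G p μ)} :
    TotallyBounded S ↔
      (∃ M : ℝ, ∀ f ∈ S, eLpNorm f p μ ≤ ENNReal.ofReal M) ∧
      (∀ ε : ℝ, 0 < ε → ∃ R : ℝ, ∀ f ∈ S,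
        eLpNorm f p (μ.restrict {x | R < ‖x‖}) < ENNReal.ofReal ε) ∧
      (∀ ε : ℝ, 0 < ε → ∃ ρ : ℝ, 0 < ρ ∧ ∀ f ∈ S, ∀ y : E, ‖y‖ < ρ →
        eLpNorm (fun x => f (x + y) - f x) p μ < ENNReal.ofReal ε) := by
  refine ⟨fun h => ⟨?_, fun ε hε => h.exists_eLpNorm_restrict_norm_gt_lt hp' hε,
    fun ε hε => h.exists_eLpNorm_translate_sub_lt hp' hε⟩,
    fun h => totallyBounded_Lp_of_tight_of_equicontinuous hp' h.1 h.2.1 h.2.2⟩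
  obtain ⟨M, hM⟩ := h.isBounded.exists_norm_le
  refine ⟨M, fun f hf => ?_⟩
  rw [← Lp.enorm_def, ← ofReal_norm]
  exact ENNReal.ofReal_le_ofReal (hM f hf)

end KolmogorovRieszLp

/-! ### Reduction of the Sobolev space to `L^p` -/

namespace SobolevSpace

variable {𝕜 : Type*} [RCLike 𝕜] {n k : ℕ} {p : ℝ≥0} [Fact (1 ≤ p)]

instance : Nonempty (MultiIndex n k) := ⟨⟨0, by simp⟩⟩

theorem isometry_jet : Isometry (jet (𝕜 := 𝕜) (n := n) (k := k) (p := p)) := by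
  refine Isometry.of_dist_eq fun f g => ?_
  have h : jet (f - g) = jet f - jet g := by
    rw [sub_eq_add_neg, jet_add, ← neg_one_smul 𝕜 g, jet_smul, neg_one_smul, sub_eq_add_neg]
  rw [dist_eq_norm, dist_eq_norm, ← h, ← norm_eq_norm_jet]

/-- Total boundedness is a uniform notion, and the `ℓ^p` sum over finitely many indices carries the
product uniformity, so the exponent of the sum plays no role. -/
theorem totallyBounded_iff_deriv {F : Set (SobolevSpace 𝕜 n k p)} :
    TotallyBounded F ↔ ∀ α : MultiIndex n k, TotallyBounded (deriv α '' F) := by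
  rw [← totallyBounded_image_iff isometry_jet.isUniformInducing,
    ← totallyBounded_image_iff
      (PiLp.uniformEquiv (p : ℝ≥0∞) _).isUniformInducing, totallyBounded_pi_iff]
  simp only [Set.image_image]
  rfl

end SobolevSpace

theorem corollary3p4 {𝕜 : Type*} [RCLike 𝕜] (n k : ℕ) (p : ℝ≥0) [Fact (1 ≤ p)]
    (F : Set (SobolevSpace 𝕜 n k p)) :
    TotallyBounded F ↔
      (∃ M : ℝ, ∀ f ∈ F, ∀ α : MultiIndex n k,
        (∫ x, ‖SobolevSpace.deriv α f x‖ ^ (p : ℝ)) < M) ∧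
      (∀ ε : ℝ, 0 < ε → ∃ R : ℝ, ∀ f ∈ F, ∀ α : MultiIndex n k,
        (∫ x in {x | R < ‖x‖}, ‖SobolevSpace.deriv α f x‖ ^ (p : ℝ)) < ε ^ (p : ℝ)) ∧
      (∀ ε : ℝ, 0 < ε → ∃ ρ : ℝ, 0 < ρ ∧ ∀ f ∈ F, ∀ α : MultiIndex n k,
        ∀ y : EuclideanSpace ℝ (Fin n), ‖y‖ < ρ →
          (∫ x, ‖SobolevSpace.deriv α f (x + y) - SobolevSpace.deriv α f x‖ ^ (p : ℝ))
            < ε ^ (p : ℝ)) := by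
  have hp1 : (1 : ℝ) ≤ p := by exact_mod_cast (Fact.out : 1 ≤ p)
  have h0 : (p : ℝ≥0∞) ≠ 0 := (one_pos.trans_le (Fact.out : (1 : ℝ≥0∞) ≤ p)).ne'
  have hp' : (p : ℝ≥0∞) ≠ ⊤ := ENNReal.coe_ne_top
  have hsub (f : Lp 𝕜 p (volume : Measure (EuclideanSpace ℝ (Fin n)))) (y) :
      MemLp (fun x => f (x + y) - f x) p volume :=
    ((Lp.memLp f).comp_measurePreserving (measurePreserving_add_right volume y)).sub (Lp.memLp f)
  rw [SobolevSpace.totallyBounded_iff_deriv]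
  simp only [totallyBounded_Lp_iff hp', Set.forall_mem_image]
  constructor
  · intro h
    refine ⟨?_, fun ε hε => ?_, fun ε hε => ?_⟩
    · choose M hM using fun α => (h α).1
      obtain ⟨m, hm⟩ := Finite.exists_le M
      -- The `+ 1` makes the inequality strict and the base positive.
      refine ⟨(|m| + 1) ^ (p : ℝ), fun f hf α => ?_⟩
      refine ((Lp.memLp _).integral_norm_rpow_lt_iff h0 hp' (by positivity)).2 ?_
      refine (hM α hf).trans_lt ((ENNReal.ofReal_lt_ofReal_iff (by positivity)).2 ?_)
      linarith [hm α, le_abs_self m]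
    · choose R hR using fun α => (h α).2.1 ε hε
      obtain ⟨r, hr⟩ := Finite.exists_le R
      refine ⟨r, fun f hf α => ?_⟩
      refine (((Lp.memLp _).restrict _).integral_norm_rpow_lt_iff h0 hp' hε).2 ?_
      refine (eLpNorm_mono_measure _ (Measure.restrict_mono_set _ ?_)).trans_lt (hR α hf)
      exact fun x hx => (hr α).trans_lt hx
    · choose ρ hρ hρ' using fun α => (h α).2.2 ε hε
      obtain ⟨β, hβ⟩ := Finite.exists_min ρ
      exact ⟨ρ β, hρ β, fun f hf α y hy => ((hsub _ y).integral_norm_rpow_lt_iff h0 hp' hε).2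
        (hρ' α hf y (hy.trans_le (hβ α)))⟩
  · rintro ⟨⟨M, hM⟩, hR, hρ⟩ α
    -- `M` bounds the `p`-th power of the norm; for a base at least `1` and `p ≥ 1` one has `M ≤
    -- (max M 1) ^ p`, so no root is needed.
    refine ⟨⟨max M 1, fun f hf => ?_⟩, fun ε hε => ?_, fun ε hε => ?_⟩
    · have h1 : 1 ≤ max M 1 := le_max_right _ _
      refine (((Lp.memLp _).integral_norm_rpow_lt_iff h0 hp' (by positivity)).1 ?_).le
      exact (hM f hf α).trans_le
        ((le_max_left _ _).trans (Real.self_le_rpow_of_one_le h1 hp1))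
    · obtain ⟨R, hR⟩ := hR ε hε
      exact ⟨R, fun f hf => (((Lp.memLp _).restrict _).integral_norm_rpow_lt_iff h0 hp' hε).1
        (hR f hf α)⟩
    · obtain ⟨ρ, hρ0, hρ⟩ := hρ ε hε
      exact ⟨ρ, hρ0, fun f hf y hy => ((hsub _ y).integral_norm_rpow_lt_iff h0 hp' hε).1
        (hρ f hf α y hy)⟩
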